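/- Let $d\ge 1$ and $0\le \ell\le 2d-1$, and let $\mu_\ell=(m_0,\dots,m_{2d-1})\in\mathbb{C}^{2d}$ be the vector with $m_\ell=1$ and $m_k=0$ for all $k\ne \ell$. Let $\tilde M_d^\ell=(m_{i+j})_{0\le i\le d-1,\;0\le j\le d}$ be the corresponding $d\times(d+1)$ Hankel matrix. For $\mu=(m_0,\dots,m_{2d-1})\in\mathbb{C}^{2d}$, say that the Prony problem of order $d$ with data $\mu$ is solvable if there exist $s\ge 0$, positive integers $d_1,\dots,d_s$ with $\sum_{j=1}^s d_j\le d$, pairwise distinct nodes $x_1,\dots,x_s\in\mathbb{C}$, and coefficients $a_{j,i}\in\mathbb{C}$ ($1\le j\le s$, $0\le i\le d_j-1$) with $a_{j,d_j-1}\ne 0$ for all $j$, such that $$\sum_{j=1}^{s}\sum_{i=0}^{d_j-1} \frac{k!}{(k-i)!}\,a_{j,i}\,x_j^{k-i}=m_k,\qquad k=0,1,\dots,2d-1,$$ where the terms with $i>k$ are read as $0$ and $0^0=1$. Then: 1. $\operatorname{rank}\tilde M_d^\ell=\ell+1$ if $\ell\le d-1$, and $\operatorname{rank}\tilde M_d^\ell=2d-\ell$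 if $\ell\ge d$. 2. The Prony problem of order $d$ with data $\mu_\ell$ is solvable if $\ell\le d-1$, and it is not solvable if $\ell\ge d$. -/

import Mathlib

/-- A signal `F = ∑_j ∑_{l < d_j} a_{j,l} δ^{(l)}(x - x_j)`, given by the number `s` of its nodes, its
multiplicity vector `(d_1, …, d_s)`, its pairwise different nodes `x_j ∈ ℂ` and its coefficients
`a_{j,l} ∈ ℂ`, `0 ≤ l ≤ d_j - 1`, the highest coefficient `a_{j,d_j-1}` at every node being
nonzero. The empty signal `s = 0` is allowed. -/
structure ConfluentSignal where
  s : ℕ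
  mult : Fin s → ℕ
  mult_pos : ∀ j, 0 < mult j
  node : Fin s → ℂ
  node_injective : Function.Injective node
  coeff : (j : Fin s) → Fin (mult j) → ℂ
  coeff_last_ne_zero : ∀ j, coeff j ⟨mult j - 1, Nat.sub_lt (mult_pos j) Nat.one_pos⟩ ≠ 0

namespace ConfluentSignal

/-- The rank `∑_j d_j` of a signal, which is the order of its multiplicity vector. -/
def rank (F : ConfluentSignal) : ℕ := ∑ j, F.mult j

/-- The left-hand side `∑_j ∑_{l < d_j} k! / (k - l)! * a_{j,l} * x_j ^ (k - l)` of the `k`-th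
equation of the confluent Prony system. Here `k.descFactorial l` is `k (k-1) ⋯ (k-l+1)`, which is
`k! / (k-l)!` for `l ≤ k` and `0` for `l > k`, so that the terms with `l > k` vanish. -/
noncomputable def moment (F : ConfluentSignal) (k : ℕ) : ℂ :=
  ∑ j, ∑ l : Fin (F.mult j),
    (k.descFactorial (l : ℕ) : ℂ) * F.coeff j l * F.node j ^ (k - (l : ℕ))

end ConfluentSignal

/-- The Prony problem of order `d` with data `m = (m_0, …, m_{2d-1})` is solvable: there are a
multiplicity vector of order at most `d`, nodes and coefficients which solve the corresponding
confluent Prony system. -/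
def PronySolvable (d : ℕ) (m : Fin (2 * d) → ℂ) : Prop :=
  ∃ F : ConfluentSignal, F.rank ≤ d ∧ ∀ k : Fin (2 * d), F.moment k = m k

/-- The `d × (d+1)` Hankel matrix `(m_{i+j})`, `0 ≤ i ≤ d - 1`, `0 ≤ j ≤ d`. -/
def hankelMatrix (d : ℕ) (m : Fin (2 * d) → ℂ) : Matrix (Fin d) (Fin (d + 1)) ℂ :=
  Matrix.of fun i j => m ⟨(i : ℕ) + (j : ℕ), by omega⟩

/-- The data vector with `m_ℓ = 1` and all other moments equal to `0`. -/
def singleMoment (d : ℕ) (ℓ : Fin (2 * d)) : Fin (2 * d) → ℂ :=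
  fun k => if k = ℓ then 1 else 0

/-! A signal of rank `r` defines a functional on polynomials that sends `X ^ k` to the `k`-th moment
and kills every multiple of its monic `nodePoly`, of degree `r`. If `r ≤ d ≤ ℓ`, the multiple
`nodePoly * X ^ (ℓ - r)` is monic of degree `ℓ`, so data concentrated at `ℓ` would give it the value
`1`: a contradiction. If `ℓ < d`, the `ℓ`-th derivative at the origin, divided by `ℓ!`, is a
solution of rank `ℓ + 1`. For the matrix rank, each column is zero or a standard basis vector, so it
suffices to count the basis vectors that occur. -/

open Polynomial in
/-- The linear functional `p ↦ ∑_j ∑_l a_{j,l} p^{(l)}(x_j)` whose values on monomials are the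
moments. -/
noncomputable def ConfluentSignal.functional (F : ConfluentSignal) : ℂ[X] →ₗ[ℂ] ℂ :=
  ∑ j, ∑ l : Fin (F.mult j),
    F.coeff j l • (Polynomial.leval (F.node j) ∘ₗ (Polynomial.derivative ^ (l : ℕ)))

open Polynomial in
theorem ConfluentSignal.functional_apply (F : ConfluentSignal) (p : ℂ[X]) :
    F.functional p = ∑ j, ∑ l : Fin (F.mult j),
      F.coeff j l * (derivative^[(l : ℕ)] p).eval (F.node j) := by
  simp [ConfluentSignal.functional, LinearMap.sum_apply, Module.End.pow_apply, leval_apply]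

open Polynomial in
theorem ConfluentSignal.functional_X_pow (F : ConfluentSignal) (k : ℕ) :
    F.functional (X ^ k) = F.moment k := by
  rw [F.functional_apply, ConfluentSignal.moment]
  refine Finset.sum_congr rfl fun j _ => Finset.sum_congr rfl fun l _ => ?_
  rw [iterate_derivative_X_pow_eq_natCast_mul]
  simp only [eval_mul, eval_natCast, eval_pow, eval_X]
  ring

open Polynomial in
/-- The monic polynomial `∏_j (X - x_j)^{d_j}`. -/
noncomputable def ConfluentSignal.nodePoly (F : ConfluentSignal) : ℂ[X] :=
  ∏ j, (X - C (F.node j)) ^ F.mult j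

theorem ConfluentSignal.nodePoly_monic (F : ConfluentSignal) : F.nodePoly.Monic :=
  Polynomial.monic_prod_of_monic _ _ fun _ _ => (Polynomial.monic_X_sub_C _).pow _

theorem ConfluentSignal.natDegree_nodePoly (F : ConfluentSignal) :
    F.nodePoly.natDegree = F.rank := by
  rw [ConfluentSignal.nodePoly, Polynomial.natDegree_prod_of_monic _ _
    fun _ _ => (Polynomial.monic_X_sub_C _).pow _]
  simp [ConfluentSignal.rank]

-- Fewer than `d_j` derivatives cannot remove a zero of order at least `d_j` at `x_j`.
open Polynomial in
theorem ConfluentSignal.functional_eq_zero_of_dvd (F : ConfluentSignal) {p : ℂ[X]}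
    (hp : F.nodePoly ∣ p) : F.functional p = 0 := by
  rw [F.functional_apply]
  refine Finset.sum_eq_zero fun j _ => Finset.sum_eq_zero fun l _ => ?_
  have h1 : (X - C (F.node j)) ^ F.mult j ∣ p :=
    (Finset.dvd_prod_of_mem (fun i => (X - C (F.node i)) ^ F.mult i) (Finset.mem_univ j)).trans hp
  have h2 : X - C (F.node j) ∣ derivative^[(l : ℕ)] p :=
    (dvd_pow_self (X - C (F.node j)) (Nat.sub_ne_zero_of_lt l.isLt)).trans
      (pow_sub_dvd_iterate_derivative_of_pow_dvd _ h1)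
  have h3 : (derivative^[(l : ℕ)] p).eval (F.node j) = 0 := dvd_iff_isRoot.mp h2
  rw [h3, mul_zero]

theorem not_pronySolvable_singleMoment {d : ℕ} {ℓ : Fin (2 * d)} (h : d ≤ (ℓ : ℕ)) :
    ¬ PronySolvable d (singleMoment d ℓ) := by
  rintro ⟨F, hF, hm⟩
  -- The subtraction is not truncated, since `F.rank ≤ d ≤ ℓ`.
  set p : Polynomial ℂ := F.nodePoly * Polynomial.X ^ ((ℓ : ℕ) - F.rank) with hp
  have hmonic : p.Monic := F.nodePoly_monic.mul (Polynomial.monic_X_pow _)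
  have hdeg : p.natDegree = ℓ := by
    rw [hp, F.nodePoly_monic.natDegree_mul (Polynomial.monic_X_pow _), F.natDegree_nodePoly,
      Polynomial.natDegree_X_pow]
    omega
  have h0 : F.functional p = 0 := F.functional_eq_zero_of_dvd (Dvd.intro _ rfl)
  have h1 : F.functional p = 1 := by
    rw [p.as_sum_range_C_mul_X_pow, hdeg, map_sum]
    simp only [← Polynomial.smul_eq_C_mul, map_smul, F.functional_X_pow, smul_eq_mul]
    rw [Finset.sum_range_succ, Finset.sum_eq_zero, hm ℓ]
    · have : p.coeff ℓ = 1 := hdeg ▸ hmonic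
      simp [singleMoment, this]
    · intro k hk
      rw [Finset.mem_range] at hk
      have hkd : k < 2 * d := hk.trans ℓ.isLt
      rw [hm ⟨k, hkd⟩, singleMoment, if_neg (fun e => hk.ne (congrArg Fin.val e)), mul_zero]
  exact zero_ne_one (h0.symm.trans h1)

/-- The signal `δ^{(n)} / n!` supported at the origin. -/
noncomputable def ConfluentSignal.deltaDerivative (n : ℕ) : ConfluentSignal where
  s := 1
  mult _ := n + 1
  mult_pos _ := n.succ_pos
  node _ := 0
  node_injective := Function.injective_of_subsingleton _
  coeff _ l := if (l : ℕ) = n then (n.factorial : ℂ)⁻¹ else 0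
  coeff_last_ne_zero _ := by simp [Nat.factorial_ne_zero]

theorem ConfluentSignal.moment_deltaDerivative (n k : ℕ) :
    (ConfluentSignal.deltaDerivative n).moment k = if k = n then 1 else 0 := by
  have key : (ConfluentSignal.deltaDerivative n).moment k =
      ∑ _j : Fin 1, ∑ l : Fin (n + 1), (k.descFactorial (l : ℕ) : ℂ) *
        (if (l : ℕ) = n then (n.factorial : ℂ)⁻¹ else 0) * 0 ^ (k - (l : ℕ)) := rfl
  rw [key, Fin.sum_univ_one, Finset.sum_eq_single (Fin.last n)]
  -- The falling factorial vanishes for `k < n`, the power of `0` for `k > n`; at `k = n` the factor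
  -- `n!` cancels and `0 ^ 0 = 1`.
  · rcases lt_trichotomy k n with h | rfl | h
    · simp [Nat.descFactorial_of_lt h, h.ne]
    · simp [Nat.descFactorial_self, Nat.factorial_ne_zero]
    · simp [h.ne', Nat.sub_ne_zero_of_lt h]
  · intro l _ hl
    have hln : (l : ℕ) ≠ n := fun e => hl (Fin.ext e)
    rw [if_neg hln, mul_zero, zero_mul]
  · simp

theorem pronySolvable_singleMoment {d : ℕ} {ℓ : Fin (2 * d)} (h : (ℓ : ℕ) < d) :
    PronySolvable d (singleMoment d ℓ) := by
  refine ⟨ConfluentSignal.deltaDerivative ℓ, ?_, fun k => ?_⟩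
  · change ∑ _j : Fin 1, ((ℓ : ℕ) + 1) ≤ d
    simpa using h
  · rw [ConfluentSignal.moment_deltaDerivative, singleMoment]
    exact if_congr Fin.ext_iff.symm rfl rfl

theorem finrank_span_image_single {n : Type*} [Fintype n] [DecidableEq n] (S : Finset n) :
    Module.finrank ℂ (Submodule.span ℂ ((fun i => Pi.single i (1 : ℂ)) '' (S : Set n) :
      Set (n → ℂ))) = S.card := by
  have hli : LinearIndependent ℂ (fun i : S => (Pi.single (i : n) (1 : ℂ) : n → ℂ)) :=
    (Pi.linearIndependent_single_one n ℂ).comp _ Subtype.val_injective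
  rw [← Fintype.card_coe S, ← finrank_span_eq_card hli]
  have hset : (fun i => (Pi.single i (1 : ℂ) : n → ℂ)) '' (S : Set n) =
      Set.range fun i : S => (Pi.single (i : n) (1 : ℂ) : n → ℂ) := by
    ext v
    simp
  rw [hset]

/-- Row `i` has its only possible `1` in column `ℓ - i`; the filter says that this index lies in `0,
…, d`. -/
theorem rank_hankelMatrix_singleMoment (d : ℕ) (ℓ : Fin (2 * d)) :
    (hankelMatrix d (singleMoment d ℓ)).rank =
      (Finset.univ.filter fun i : Fin d => (i : ℕ) ≤ ℓ ∧ (ℓ : ℕ) ≤ i + d).card := by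
  rw [Matrix.rank_eq_finrank_span_cols, ← finrank_span_image_single]
  have hentry (i : Fin d) (j : Fin (d + 1)) :
      (hankelMatrix d (singleMoment d ℓ)).col j i = if (i : ℕ) + j = ℓ then 1 else 0 := by
    simp [hankelMatrix, singleMoment, Fin.ext_iff]
  suffices h : Submodule.span ℂ (Set.range (hankelMatrix d (singleMoment d ℓ)).col) =
      Submodule.span ℂ ((fun i => Pi.single i (1 : ℂ)) ''
        ((Finset.univ.filter fun i : Fin d => (i : ℕ) ≤ ℓ ∧ (ℓ : ℕ) ≤ i + d : Finset (Fin d)) :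
          Set (Fin d)) : Set (Fin d → ℂ)) by
    rw [h]
  have hcol (i : Fin d) (j : Fin (d + 1)) (hij : (i : ℕ) + j = ℓ) :
      (hankelMatrix d (singleMoment d ℓ)).col j = Pi.single i 1 := by
    ext i'
    rw [hentry, Pi.single_apply]
    exact if_congr ⟨fun h => Fin.ext (by omega), fun h => h ▸ hij⟩ rfl rfl
  refine le_antisymm (Submodule.span_le.mpr ?_) (Submodule.span_mono ?_)
  · rintro _ ⟨j, rfl⟩
    by_cases h : ∃ i : Fin d, (i : ℕ) + j = ℓ
    · obtain ⟨i, hi⟩ := h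
      refine Submodule.subset_span ⟨i, ?_, (hcol i j hi).symm⟩
      simp only [Finset.coe_filter, Finset.mem_univ, true_and, Set.mem_ofPred_eq]
      omega
    · have h0 : (hankelMatrix d (singleMoment d ℓ)).col j = 0 := by
        ext i
        rw [hentry, if_neg (fun e => h ⟨i, e⟩), Pi.zero_apply]
      rw [h0]
      exact Submodule.zero_mem _
  · rintro _ ⟨i, hi, rfl⟩
    simp only [Finset.coe_filter, Finset.mem_univ, true_and, Set.mem_ofPred_eq] at hi
    exact ⟨⟨(ℓ : ℕ) - i, by omega⟩, hcol i _ (by simp only; omega)⟩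

/-- These `i` form the interval `[n - d, min (n + 1) d)`; truncated subtraction covers `n < d` as
well. -/
theorem card_filter_le_and_le_add (d n : ℕ) :
    (Finset.univ.filter fun i : Fin d => (i : ℕ) ≤ n ∧ n ≤ i + d).card =
      min (n + 1) d - (n - d) := by
  rw [← Nat.card_Ico, ← Finset.card_map Fin.valEmbedding]
  congr 1
  ext k
  simp only [Finset.mem_map, Finset.mem_filter, Finset.mem_univ, true_and,
    Fin.valEmbedding_apply, Finset.mem_Ico]
  constructor
  · rintro ⟨i, hi, rfl⟩
    omega
  · intro hk
    exact ⟨⟨k, by omega⟩, by simp only; omega, rfl⟩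

theorem mainTheorem9 (d : ℕ) (hd : 1 ≤ d) (ℓ : Fin (2 * d)) :
    ((ℓ : ℕ) ≤ d - 1 → (hankelMatrix d (singleMoment d ℓ)).rank = (ℓ : ℕ) + 1) ∧
    (d ≤ (ℓ : ℕ) → (hankelMatrix d (singleMoment d ℓ)).rank = 2 * d - (ℓ : ℕ)) ∧
    ((ℓ : ℕ) ≤ d - 1 → PronySolvable d (singleMoment d ℓ)) ∧
    (d ≤ (ℓ : ℕ) → ¬ PronySolvable d (singleMoment d ℓ)) := by
  rw [rank_hankelMatrix_singleMoment, card_filter_le_and_le_add]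
  exact ⟨fun h => by omega, fun h => by omega,
    fun h => pronySolvable_singleMoment (by omega), not_pronySolvable_singleMoment⟩
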